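/- Let $\mathbb{K}$ be a field, let $G$ be a finite simple graph with vertex set $\{v_1,\dots,v_n\}$, let $S=\mathbb{K}[x_1,\dots,x_n]$ with its standard $\mathbb{Z}^n$-grading, and let $I(G)\subseteq S$ be the edge ideal of $G$, generated by the monomials $x_ix_j$ with $\{v_i,v_j\}$ an edge of $G$. For a $\mathbb{Z}^n$-graded $S$-module $M$, a homogeneous element $u\in M$ and a set $Z\subseteq\{x_1,\dots,x_n\}$, the $\mathbb{K}$-subspace $u\mathbb{K}[Z]=\{uf : f\in\mathbb{K}[Z]\}$ of $M$ is called a Stanley space of dimension $|Z|$ if it is a free $\mathbb{K}[Z]$-module with basis $u$. A Stanley decomposition of $M$ is a decomposition of $M$, as a $\mathbb{K}$-vector space, into a finite direct sum of Stanley spaces; its Stanley depth is the minimum of the dimensions of these Stanley spaces. The Stanley depth $\operatorname{sdepth}(M)$ of a nonzero finitely generated $\mathbb{Z}^n$-graded module $M$ is the maximum of the Stanley depths of its Stanley decompositions. Suppose that $G$ is not bipartite, and let $p$ be the number of connected components of $G$ which are bipartite (an isolated vertex counts as a bipartite connected component). Then for every integer $k\geq 1$, $$\operatorname{sdepth}(I(G)^k)\geq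 p+1 .$$ -/

import Mathlib

noncomputable section

namespace StanleyDepth

/-- The edge ideal `I(G)` in `S = K[x_v : v ∈ V]`, generated by the monomials `x_v x_w` with
`{v, w}` an edge of `G`. -/
def edgeIdeal (K : Type*) [Field K] {V : Type*} (G : SimpleGraph V) : Ideal (MvPolynomial V K) :=
  Ideal.span {f | ∃ v w : V, G.Adj v w ∧ f = MvPolynomial.X v * MvPolynomial.X w}

/-- The number of connected components of `G` which (as graphs) are bipartite. An isolated vertex
is a bipartite connected component. -/
def numBipartiteComponents {V : Type*} (G : SimpleGraph V) : ℕ :=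
  Set.ncard {C : G.ConnectedComponent | C.toSimpleGraph.IsBipartite}

section Module

variable {K : Type*} [Field K] {V : Type*} {M : Type*} [AddCommGroup M] [Module K M]
  [Module (MvPolynomial V K) M] [IsScalarTower K (MvPolynomial V K) M]

/-- The `K`-linear map `S → M`, `f ↦ f u`. -/
def mulLeft (u : M) : MvPolynomial V K →ₗ[K] M :=
  (LinearMap.toSpanSingleton (MvPolynomial V K) M u).restrictScalars K

/-- The `K`-subspace `u K[Z]` of `M`, consisting of all `f u` with `f ∈ K[Z]`. -/
def stanleySpace (u : M) (Z : Finset V) : Submodule K M :=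
  (Subalgebra.toSubmodule (MvPolynomial.supported K (Z : Set V))).map (mulLeft u)

/-- A Stanley decomposition of the `S`-module `M`, graded by `ℤ^V` with components `𝓜 d`: finitely
many homogeneous elements `u i` and sets of variables `Z i`, such that each `u i K[Z i]` is a free
`K[Z i]`-module with basis `u i`, and `M` is the direct sum of these subspaces. -/
structure Decomposition (𝓜 : (V → ℤ) → Submodule K M) where
  /-- the number of Stanley spaces -/
  size : ℕ
  /-- the generators -/
  u : Fin size → M
  /-- the sets of variables -/
  Z : Fin size → Finset V
  homogeneous : ∀ i, ∃ d : V → ℤ, u i ∈ 𝓜 d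
  free : ∀ i, Set.InjOn (fun f : MvPolynomial V K => f • u i)
    (MvPolynomial.supported K (Z i : Set V) : Set (MvPolynomial V K))
  isInternal : DirectSum.IsInternal (fun i => stanleySpace (K := K) (u i) (Z i))

/-- The Stanley depth of a Stanley decomposition: the least dimension `|Z i|` of its Stanley
spaces (`⊤` if there are none, which happens only for the zero module). -/
def Decomposition.sdepth {𝓜 : (V → ℤ) → Submodule K M} (D : Decomposition 𝓜) : ℕ∞ :=
  ⨅ i, ((D.Z i).card : ℕ∞)

/-- The Stanley depth of a graded module: the largest Stanley depth of its Stanley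
decompositions. For finite `V` and `M ≠ 0` the supremum ranges over numbers `≤ |V|`. -/
def sdepth (𝓜 : (V → ℤ) → Submodule K M) : ℕ∞ :=
  ⨆ D : Decomposition 𝓜, D.sdepth

end Module

/-- The component of degree `d ∈ ℤ^V` of `S`: spanned by `x^d` if `d` is nonnegative, and zero
otherwise. -/
def ringComponent (K : Type*) [Field K] {V : Type*} (d : V → ℤ) :
    Submodule K (MvPolynomial V K) :=
  Submodule.span K {f | ∃ e : V →₀ ℕ, (∀ v, (e v : ℤ) = d v) ∧ f = MvPolynomial.monomial e 1}

/-- The degree `d` component `I ∩ S_d` of an ideal `I` of `S`; for a monomial ideal these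
components form its `ℤ^V`-grading. -/
def idealComponent {K : Type*} [Field K] {V : Type*} (I : Ideal (MvPolynomial V K)) (d : V → ℤ) :
    Submodule K I :=
  (ringComponent K d).comap ((Submodule.subtype I).restrictScalars K)

/-- The Stanley depth of a monomial ideal `I` of `S`, as a `ℤ^V`-graded `S`-module. -/
def idealSdepth {K : Type*} [Field K] {V : Type*} (I : Ideal (MvPolynomial V K)) : ℕ∞ :=
  sdepth (idealComponent I)

end StanleyDepth

end

/-! The monomials of `I(G)^k` are the `x^a` such that `G` has a matching of size `k` with vertex
multiplicities `a`. Matchings split over blocks without edges between them: take one block for each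
bipartite component and one more, nonempty because `G` is not bipartite, for all the others. This
gives `p + 1` blocks, and `a` belongs to `I(G)^k` iff the block matching numbers, truncated at `k`,
add up to at least `k` (`hasMatching_iff_le_sum`).

In a bipartite block, Kőnig's theorem gives a vertex cover whose weight is the matching number;
raising `a` at a vertex outside it changes nothing (`exists_flat_vertex`). So every exponent has a
free direction in each bipartite block. In the extra block any direction will do: moving up never
leaves the ideal, and the level of that one block need not be recorded. Choosing directions
consistently cuts the exponents into finitely many orthants, each free in at least one direction per
block (`exists_partition`). These are the Stanley spaces. -/

open StanleyDepth

/-! ### From partitions of exponents to Stanley decompositions; powers of edge ideals. -/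

section Algebra

variable {K : Type*} [Field K] {V : Type*}

theorem mem_supported_iff_support {f : MvPolynomial V K} {Z : Set V} :
    f ∈ MvPolynomial.supported K Z ↔ ∀ a ∈ f.support, (a.support : Set V) ⊆ Z := by
  rw [MvPolynomial.mem_supported]
  constructor
  · intro h a ha v hv
    exact h ((MvPolynomial.mem_vars_iff_mem_support v).2 ⟨a, ha, hv⟩)
  · intro h v hv
    obtain ⟨a, ha, hv⟩ := (MvPolynomial.mem_vars_iff_mem_support v).1 hv
    exact h a ha hv

theorem mem_stanleySpace_monomial {I : Ideal (MvPolynomial V K)} {m : V →₀ ℕ} {u : I}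
    (hu : (u : MvPolynomial V K) = MvPolynomial.monomial m 1) {Z : Finset V} {f : I} :
    f ∈ stanleySpace (K := K) u Z ↔
      ∀ a ∈ (f : MvPolynomial V K).support, ∃ d : V →₀ ℕ, d.support ⊆ Z ∧ a = m + d := by
  classical
  constructor
  · rintro ⟨g, hg, rfl⟩ a ha
    have hg' := mem_supported_iff_support.1 ((Subalgebra.mem_toSubmodule _).1 hg)
    have hval : ((mulLeft (K := K) u g : I) : MvPolynomial V K) =
        g * MvPolynomial.monomial m 1 := by
      rw [← hu]; rfl
    rw [hval, MvPolynomial.mem_support_iff, MvPolynomial.coeff_mul_monomial'] at ha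
    split_ifs at ha with hma
    · refine ⟨a - m, ?_, (add_tsub_cancel_of_le hma).symm⟩
      exact_mod_cast hg' (a - m) (by simpa using ha)
    · exact absurd rfl ha
  · intro h
    refine ⟨MvPolynomial.divMonomial (f : MvPolynomial V K) m, ?_, ?_⟩
    · refine (Subalgebra.mem_toSubmodule _).2 (mem_supported_iff_support.2 fun d hd => ?_)
      rw [MvPolynomial.mem_support_iff, MvPolynomial.coeff_divMonomial,
        ← MvPolynomial.mem_support_iff] at hd
      obtain ⟨d', hd', h'⟩ := h _ hd
      rw [add_left_cancel h']
      exact_mod_cast hd'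
    · apply Subtype.ext
      have hval : ((mulLeft (K := K) u (MvPolynomial.divMonomial (f : MvPolynomial V K) m) : I) :
          MvPolynomial V K) =
          MvPolynomial.divMonomial (f : MvPolynomial V K) m * MvPolynomial.monomial m 1 := by
        rw [← hu]; rfl
      rw [hval]
      ext a
      rw [MvPolynomial.coeff_mul_monomial']
      split_ifs with hma
      · rw [mul_one, MvPolynomial.coeff_divMonomial, add_tsub_cancel_of_le hma]
      · by_contra hne
        obtain ⟨d, -, rfl⟩ := h a (MvPolynomial.mem_support_iff.2 (Ne.symm hne))
        exact hma le_self_add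

/-- The elements of an ideal all of whose monomials have exponents in `E`. -/
def exponentsIn (I : Ideal (MvPolynomial V K)) (E : Set (V →₀ ℕ)) : Submodule K I where
  carrier := {f | ∀ a ∈ (f : MvPolynomial V K).support, a ∈ E}
  zero_mem' := by simp
  add_mem' := by
    classical
    intro f g hf hg a ha
    rcases Finset.mem_union.1 (MvPolynomial.support_add ha) with h | h
    exacts [hf a h, hg a h]
  smul_mem' := by
    intro r f hf a ha
    exact hf a (MvPolynomial.support_smul ha)

/-- A partition of the exponents of a monomial ideal into translated coordinate orthants of
dimension at least `n` bounds the Stanley depth from below. -/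
theorem le_idealSdepth_of_partition {I : Ideal (MvPolynomial V K)} {A : Set (V →₀ ℕ)}
    (hI : ∀ f, f ∈ I ↔ ∀ a ∈ f.support, a ∈ A) {J : Type*} [Finite J]
    (E : J → Set (V →₀ ℕ)) (m : J → V →₀ ℕ) (Z : J → Finset V)
    (hE : ∀ j a, a ∈ E j ↔ ∃ d : V →₀ ℕ, d.support ⊆ Z j ∧ a = m j + d)
    (hA : ∀ a, a ∈ A ↔ ∃ j, a ∈ E j)
    (hdisj : ∀ i j a, a ∈ E i → a ∈ E j → i = j)
    {n : ℕ} (hn : ∀ j, n ≤ (Z j).card) : (n : ℕ∞) ≤ idealSdepth I := by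
  classical
  have hm : ∀ j, m j ∈ A := fun j => (hA _).2 ⟨j, (hE j _).2 ⟨0, by simp, by simp⟩⟩
  have hmono : ∀ {a : V →₀ ℕ}, a ∈ A → ∀ r : K, MvPolynomial.monomial a r ∈ I := by
    intro a ha r
    rw [hI]
    intro b hb
    rwa [Finset.mem_singleton.1 (MvPolynomial.support_monomial_subset hb)]
  let u : J → I := fun j => ⟨MvPolynomial.monomial (m j) 1, hmono (hm j) 1⟩
  have hspace : ∀ j, stanleySpace (K := K) (u j) (Z j) = exponentsIn I (E j) := by
    intro j
    ext f
    rw [mem_stanleySpace_monomial (m := m j) rfl]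
    exact forall₂_congr fun a _ => (hE j a).symm
  let e := (Finite.equivFin J).symm
  let D : Decomposition (idealComponent I) :=
    { size := Nat.card J
      u := fun i => u (e i)
      Z := fun i => Z (e i)
      homogeneous := fun i => ⟨fun v => m (e i) v, Submodule.subset_span ⟨m (e i), by simp, rfl⟩⟩
      free := by
        intro i f _ g _ hfg
        have h : f * MvPolynomial.monomial (m (e i)) (1 : K) =
            g * MvPolynomial.monomial (m (e i)) 1 := congrArg Subtype.val hfg
        exact mul_right_cancel₀ (by simp) h
      isInternal := by
        simp only [hspace]
        apply DirectSum.isInternal_submodule_of_iSupIndep_of_iSup_eq_top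
        · intro i
          rw [Submodule.disjoint_def]
          intro f hf hf'
          have hle : (⨆ j, ⨆ _ : j ≠ i, exponentsIn I (E (e j))) ≤
              exponentsIn I {a | ∃ j, j ≠ i ∧ a ∈ E (e j)} :=
            iSup₂_le fun j hj g hg a ha => ⟨j, hj, hg a ha⟩
          apply Subtype.ext
          rw [Submodule.coe_zero, ← MvPolynomial.support_eq_empty, Finset.eq_empty_iff_forall_notMem]
          intro a ha
          obtain ⟨j, hj, haj⟩ := hle hf' a ha
          exact hj (e.injective (hdisj _ _ a haj (hf a ha)))
        · rw [eq_top_iff]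
          intro f _
          have hfA := (hI f).1 f.2
          have hsum : f = ∑ a ∈ (f : MvPolynomial V K).support.attach,
              (⟨MvPolynomial.monomial a.1 ((f : MvPolynomial V K).coeff a.1),
                hmono (hfA a.1 a.2) _⟩ : I) := by
            apply Subtype.ext
            rw [AddSubmonoidClass.coe_finsetSum]
            change (f : MvPolynomial V K) = ∑ a ∈ (f : MvPolynomial V K).support.attach,
              MvPolynomial.monomial a.1 ((f : MvPolynomial V K).coeff a.1)
            rw [Finset.sum_attach _ (fun a => MvPolynomial.monomial a
              ((f : MvPolynomial V K).coeff a))]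
            exact MvPolynomial.as_sum _
          rw [hsum]
          refine Submodule.sum_mem _ fun a _ => ?_
          obtain ⟨j, hj⟩ := (hA a.1).1 (hfA a.1 a.2)
          refine Submodule.mem_iSup_of_mem (e.symm j) ?_
          rw [Equiv.apply_symm_apply]
          intro b hb
          rwa [Finset.mem_singleton.1 (MvPolynomial.support_monomial_subset hb)] }
  exact le_iSup_of_le D (le_iInf fun i => by exact_mod_cast hn (e i))

/-- `a` dominates a sum of `m` elements of `E`, with repetitions. -/
def HasMatching {V : Type*} (E : Set (V →₀ ℕ)) (m : ℕ) (a : V →₀ ℕ) : Prop :=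
  ∃ s : Multiset (V →₀ ℕ), (∀ e ∈ s, e ∈ E) ∧ s.card = m ∧ s.sum ≤ a

theorem span_monomial_pow (E : Set (V →₀ ℕ)) (k : ℕ) :
    Ideal.span ((fun a => MvPolynomial.monomial a (1 : K)) '' E) ^ k =
      Ideal.span ((fun a => MvPolynomial.monomial a (1 : K)) ''
        {a | ∃ s : Multiset (V →₀ ℕ), (∀ e ∈ s, e ∈ E) ∧ s.card = k ∧ s.sum = a}) := by
  induction k with
  | zero =>
    rw [pow_zero, Ideal.one_eq_top, eq_comm, Ideal.eq_top_iff_one]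
    exact Ideal.subset_span ⟨0, ⟨0, by simp, by simp, by simp⟩, rfl⟩
  | succ k ih =>
    rw [pow_succ, ih, Ideal.span_mul_span']
    congr 1
    ext f
    constructor
    · rintro ⟨_, ⟨a, ⟨s, hs, hk, rfl⟩, rfl⟩, _, ⟨e, he, rfl⟩, rfl⟩
      refine ⟨s.sum + e, ⟨e ::ₘ s, ?_, by simp [hk], by simp [add_comm]⟩, by simp⟩
      intro x hx
      rcases Multiset.mem_cons.1 hx with rfl | hx
      exacts [he, hs x hx]
    · rintro ⟨_, ⟨s, hs, hk, rfl⟩, rfl⟩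
      obtain ⟨e, he⟩ := Multiset.card_pos_iff_exists_mem.1 (by omega : 0 < s.card)
      obtain ⟨s, rfl⟩ := Multiset.exists_cons_of_mem he
      refine ⟨_, ⟨s.sum, ⟨s, fun x hx => hs x (Multiset.mem_cons_of_mem hx), by simpa using hk,
        rfl⟩, rfl⟩, _, ⟨e, hs e he, rfl⟩, by simp [add_comm]⟩

/-- The exponents of the products `x_v x_w`, for `{v, w}` an edge. -/
def edgeExponents (G : SimpleGraph V) : Set (V →₀ ℕ) :=
  {e | ∃ v w, G.Adj v w ∧ e = Finsupp.single v 1 + Finsupp.single w 1}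

theorem mem_edgeIdeal_pow (G : SimpleGraph V) (k : ℕ) (f : MvPolynomial V K) :
    f ∈ edgeIdeal K G ^ k ↔ ∀ a ∈ f.support, HasMatching (edgeExponents G) k a := by
  have h : edgeIdeal K G =
      Ideal.span ((fun a => MvPolynomial.monomial a (1 : K)) '' edgeExponents G) := by
    unfold edgeIdeal
    congr 1
    ext f
    constructor
    · rintro ⟨v, w, hvw, rfl⟩
      exact ⟨_, ⟨v, w, hvw, rfl⟩, by simp [MvPolynomial.X]⟩
    · rintro ⟨_, ⟨v, w, hvw, rfl⟩, rfl⟩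
      exact ⟨v, w, hvw, by simp [MvPolynomial.X]⟩
  rw [h, span_monomial_pow, MvPolynomial.mem_ideal_span_monomial_image]
  refine forall₂_congr fun a _ => ⟨?_, ?_⟩
  · rintro ⟨_, ⟨s, hs, hk, rfl⟩, hle⟩
    exact ⟨s, hs, hk, hle⟩
  · rintro ⟨s, hs, hk, hle⟩
    exact ⟨_, ⟨s, hs, hk, rfl⟩, hle⟩

end Algebra

universe u w

/-! ### Partitioning an up-set of exponents into orthants. -/

section Partition

variable {V : Type u} {ι : Type w}

/-- `a` and `b` have the same truncations at `N` on the set `S`. -/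
def TruncEqOn (N : ℕ) (S : Set V) (a b : V →₀ ℕ) : Prop :=
  ∀ v ∈ S, min (a v) N = min (b v) N

theorem TruncEqOn.add {N : ℕ} {S : Set V} {a b : V →₀ ℕ} (h : TruncEqOn N S a b) (d : V →₀ ℕ) :
    TruncEqOn N S (a + d) (b + d) := by
  intro v hv
  have := h v hv
  simp only [Finsupp.add_apply]
  omega

/-- `t` depends only on the coordinates in `S`, truncated at `N`. -/
def IsLocal (N : ℕ) (S : Set V) (t : (V →₀ ℕ) → ℕ) : Prop :=
  ∀ a b, TruncEqOn N S a b → t a = t b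

/-- The directions in `S` along which `t` stays constant from `a` on. -/
def flatDirections (t : (V →₀ ℕ) → ℕ) (S : Set V) (a : V →₀ ℕ) : Set V :=
  {v | v ∈ S ∧ ∀ n, t (a + Finsupp.single v n) = t a}

theorem flatDirections_congr {N : ℕ} {S : Set V} {t : (V →₀ ℕ) → ℕ} (ht : IsLocal N S t)
    {a b : V →₀ ℕ} (h : TruncEqOn N S a b) : flatDirections t S a = flatDirections t S b := by
  ext v
  refine and_congr_right fun _ => forall_congr' fun n => ?_
  rw [ht _ _ (h.add _), ht _ _ h]

/-- Climbing at constant level can lose flat directions but never gain any. This keeps the chosen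
direction stable along an orthant. -/
theorem flatDirections_anti {S : Set V} {t : (V →₀ ℕ) → ℕ} (ht : Monotone t) {a b : V →₀ ℕ}
    (hab : a ≤ b) (h : t a = t b) : flatDirections t S b ⊆ flatDirections t S a := by
  rintro v ⟨hv, hb⟩
  refine ⟨hv, fun n => le_antisymm ?_ (ht le_self_add)⟩
  calc t (a + Finsupp.single v n) ≤ t (b + Finsupp.single v n) := ht (by gcongr)
    _ = t a := by rw [hb, h]

/-- If `A` is an up-set cut out by `k ≤ ∑ i, t i`, with the `t i` depending on disjoint blocks of
variables and constant along some direction at each point, all but one of them, then `A` is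
partitioned into translated orthants whose dimensions are at least the number of blocks. -/
theorem exists_partition [Finite V] [Fintype ι] (c : V → ι) (N k : ℕ)
    (t : ι → (V →₀ ℕ) → ℕ) (hmono : ∀ i, Monotone (t i))
    (hloc : ∀ i, IsLocal N (c ⁻¹' {i}) (t i)) (i₀ : ι) (hi₀ : ∃ v, c v = i₀)
    (hflat : ∀ i ≠ i₀, ∀ a, (flatDirections (t i) (c ⁻¹' {i}) a).Nonempty)
    (A : Set (V →₀ ℕ)) (hA : ∀ a, a ∈ A ↔ k ≤ ∑ i, t i a) :
    ∃ (J : Type (max u w)) (_ : Finite J) (E : J → Set (V →₀ ℕ)) (m : J → V →₀ ℕ) (Z : J → Finset V),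
      (∀ j a, a ∈ E j ↔ ∃ d : V →₀ ℕ, d.support ⊆ Z j ∧ a = m j + d) ∧
      (∀ a, a ∈ A ↔ ∃ j, a ∈ E j) ∧ (∀ i j a, a ∈ E i → a ∈ E j → i = j) ∧
      ∀ j, Fintype.card ι ≤ (Z j).card := by
  classical
  obtain ⟨_, _⟩ := exists_wellFoundedLT V
  -- the levels, ignoring the block `i₀`
  let τ : ι → (V →₀ ℕ) → ℕ := fun i => if i = i₀ then fun _ => 0 else t i
  have hτ0 : ∀ a, τ i₀ a = 0 := fun a => by simp [τ]
  have hτ : ∀ i ≠ i₀, τ i = t i := fun i hi => by simp [τ, hi]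
  have τmono : ∀ i, Monotone (τ i) := by
    intro i
    by_cases hi : i = i₀
    · subst hi
      intro a b _
      simp [hτ0]
    · rw [hτ i hi]; exact hmono i
  have τloc : ∀ i, IsLocal N (c ⁻¹' {i}) (τ i) := by
    intro i
    by_cases hi : i = i₀
    · subst hi
      intro a b _
      simp [hτ0]
    · rw [hτ i hi]; exact hloc i
  have τflat : ∀ i a, (flatDirections (τ i) (c ⁻¹' {i}) a).Nonempty := by
    intro i a
    by_cases hi : i = i₀
    · subst hi
      obtain ⟨v, hv⟩ := hi₀
      exact ⟨v, hv, fun n => by simp [hτ0]⟩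
    · rw [hτ i hi]; exact hflat i hi a
  -- the chosen directions
  let D : ι → (V →₀ ℕ) → Set V := fun i a => flatDirections (τ i) (c ⁻¹' {i}) a
  let σ : (V →₀ ℕ) → ι → V := fun a i => WellFounded.min wellFounded_lt (D i a) (τflat i a)
  have σmem : ∀ a i, σ a i ∈ D i a := fun a i => WellFounded.min_mem _ _ _
  have cσ : ∀ a i, c (σ a i) = i := fun a i => (σmem a i).1
  have σcongr : ∀ a b i, D i a = D i b → σ a i = σ b i := by
    intro a b i h
    simp only [σ, h]
  -- The reason for choosing the least flat direction: a minimum that survives in a subset is still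
  -- the minimum there.
  have σstable : ∀ a b i, D i b ⊆ D i a → σ a i ∈ D i b → σ b i = σ a i := by
    intro a b i h h'
    exact le_antisymm (not_lt.1 (WellFounded.not_lt_min _ _ h'))
      (not_lt.1 (WellFounded.not_lt_min _ _ (h (σmem b i))))
  -- The orthants will be the fibres of `κ` on `A`. The coordinates in the chosen directions are
  -- erased, hence unconstrained.
  let κ : (V →₀ ℕ) → (ι → ℕ) × (ι → V) × (V → ℕ) := fun a =>
    (fun i => τ i a, σ a, fun v => if v = σ a (c v) then 0 else min (a v) N)
  have κeq : ∀ a b, κ a = κ b ↔ (∀ i, τ i a = τ i b) ∧ σ a = σ b ∧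
      ∀ v, v ≠ σ a (c v) → min (a v) N = min (b v) N := by
    intro a b
    constructor
    · intro h
      simp only [κ, Prod.mk.injEq] at h
      refine ⟨congrFun h.1, h.2.1, fun v hv => ?_⟩
      have h3 := congrFun h.2.2 v
      rw [← h.2.1] at h3
      simpa [hv] using h3
    · rintro ⟨h1, h2, h3⟩
      simp only [κ, Prod.mk.injEq]
      refine ⟨funext h1, h2, funext fun v => ?_⟩
      rw [← h2]
      split_ifs with hv
      exacts [rfl, h3 v hv]
  -- finitely many classes
  have hfin : (κ '' A).Finite := by
    have hbox : (Set.Iic (Finsupp.equivFunOnFinite.symm fun _ : V => N)).Finite :=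
      Set.finite_Iic _
    refine (hbox.image κ).subset ?_
    rintro _ ⟨a, -, rfl⟩
    have htr : ∀ S, TruncEqOn N S
        (a ⊓ (Finsupp.equivFunOnFinite.symm fun _ : V => N)) a := by
      intro S v _
      simp [Finsupp.inf_apply]
    refine ⟨a ⊓ (Finsupp.equivFunOnFinite.symm fun _ : V => N), Set.mem_Iic.2 inf_le_right, ?_⟩
    rw [κeq]
    exact ⟨fun i => τloc i _ _ (htr _),
      funext fun i => σcongr _ _ _ (flatDirections_congr (τloc i) (htr _)),
      fun v _ => htr Set.univ v trivial⟩
  -- each class is closed under infima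
  have hinf : ∀ a ∈ A, ∀ b ∈ A, κ a = κ b → a ⊓ b ∈ A ∧ κ (a ⊓ b) = κ b := by
    intro a ha b hb hab
    obtain ⟨h1, h2, h3⟩ := (κeq a b).1 hab
    -- Within a block the truncations of `a` and `b` can differ only at the single chosen vertex, so
    -- there the infimum looks like whichever is smaller at that vertex.
    have hblock : ∀ i, TruncEqOn N (c ⁻¹' {i}) (a ⊓ b) a ∨
        TruncEqOn N (c ⁻¹' {i}) (a ⊓ b) b := by
      intro i
      rcases le_total (a (σ a i)) (b (σ a i)) with hle | hle
      · refine Or.inl fun v hv => ?_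
        obtain rfl : c v = i := hv
        by_cases hvσ : v = σ a (c v)
        · rw [← hvσ] at hle
          rw [Finsupp.inf_apply, inf_eq_left.2 hle]
        · have := h3 v hvσ
          rw [Finsupp.inf_apply]
          change min (min (a v) (b v)) N = _
          omega
      · refine Or.inr fun v hv => ?_
        obtain rfl : c v = i := hv
        by_cases hvσ : v = σ a (c v)
        · rw [← hvσ] at hle
          rw [Finsupp.inf_apply, inf_eq_right.2 hle]
        · have := h3 v hvσ
          rw [Finsupp.inf_apply]
          change min (min (a v) (b v)) N = _
          omega
    have hτinf : ∀ i, τ i (a ⊓ b) = τ i b := by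
      intro i
      rcases hblock i with h | h
      · rw [τloc i _ _ h, h1]
      · exact τloc i _ _ h
    have hσinf : σ (a ⊓ b) = σ b := by
      funext i
      rcases hblock i with h | h
      · rw [σcongr _ _ _ (flatDirections_congr (τloc i) h), h2]
      · exact σcongr _ _ _ (flatDirections_congr (τloc i) h)
    constructor
    -- `κ` does not see the level of block `i₀`, so membership is inherited from whichever of `a`,
    -- `b` agrees with the infimum on that block.
    · have hsum : ∀ d, (t i₀ (a ⊓ b) = t i₀ d) → (∀ i, τ i (a ⊓ b) = τ i d) → d ∈ A →
          a ⊓ b ∈ A := by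
        intro d h0 hd hdA
        rw [hA] at hdA ⊢
        refine hdA.trans_eq (Finset.sum_congr rfl fun i _ => ?_)
        by_cases hi : i = i₀
        · rw [hi, h0]
        · rw [← hτ i hi, hd]
      rcases hblock i₀ with h | h
      · exact hsum a (hloc i₀ _ _ h) (fun i => (hτinf i).trans (h1 i).symm) ha
      · exact hsum b (hloc i₀ _ _ h) hτinf hb
    · rw [κeq]
      refine ⟨hτinf, hσinf, fun v hv => ?_⟩
      rw [hσinf, ← h2] at hv
      have := h3 v hv
      rw [Finsupp.inf_apply]
      change min (min (a v) (b v)) N = _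
      omega
  have hleast : ∀ j : κ '' A, ∃ m ∈ A, κ m = j ∧ ∀ a ∈ A, κ a = j → m ≤ a := by
    rintro ⟨_, a, ha, rfl⟩
    obtain ⟨m, ⟨hmA, hm⟩, hmin⟩ := WellFounded.has_min (wellFounded_lt (α := V →₀ ℕ))
      {b | b ∈ A ∧ κ b = κ a} ⟨a, ha, rfl⟩
    refine ⟨m, hmA, hm, fun b hb hba => ?_⟩
    have h := hinf b hb m hmA (hba.trans hm.symm)
    have hnot := hmin (b ⊓ m) ⟨h.1, h.2.trans hm⟩
    by_contra hmb
    exact hnot (inf_lt_right.2 hmb)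
  choose m hmA hmκ hmle using hleast
  have := Fintype.ofFinite V
  refine ⟨κ '' A, hfin, fun j => {a | a ∈ A ∧ κ a = j}, m,
    -- Free variables: the chosen directions, and those whose coordinate has already reached the
    -- truncation bound.
    fun j => Finset.univ.filter fun v => v = σ (m j) (c v) ∨ N ≤ m j v, ?_, ?_, ?_, ?_⟩
  · intro j a
    constructor
    · rintro ⟨ha, haj⟩
      refine ⟨a - m j, fun v hv => ?_, (add_tsub_cancel_of_le (hmle j a ha haj)).symm⟩
      rw [Finset.mem_filter]
      refine ⟨Finset.mem_univ _, ?_⟩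
      by_contra hcon
      push Not at hcon
      have h3 := ((κeq (m j) a).1 ((hmκ j).trans haj.symm)).2.2 v hcon.1
      rw [Finsupp.mem_support_iff, Finsupp.tsub_apply] at hv
      omega
    · rintro ⟨d, hd, rfl⟩
      have htr : ∀ v, v ≠ σ (m j) (c v) → min ((m j + d) v) N = min (m j v) N := by
        intro v hv
        rw [Finsupp.add_apply]
        by_cases hdv : d v = 0
        · rw [hdv, add_zero]
        · have := (Finset.mem_filter.1 (hd (Finsupp.mem_support_iff.2 hdv))).2
          have := this.resolve_left hv
          omega
      -- Up to truncation, adding `d` moves block `i` only along its chosen flat direction.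
      have hline : ∀ i, TruncEqOn N (c ⁻¹' {i}) (m j + d)
          (m j + Finsupp.single (σ (m j) i) (d (σ (m j) i))) := by
        rintro i v hv
        obtain rfl : c v = i := hv
        by_cases hvσ : v = σ (m j) (c v)
        · rw [← hvσ]; simp
        · rw [htr v hvσ, Finsupp.add_apply, Finsupp.single_eq_of_ne hvσ, add_zero]
      have hτm : ∀ i, τ i (m j + d) = τ i (m j) := fun i => by
        rw [τloc i _ _ (hline i)]
        exact (σmem (m j) i).2 _
      have hσm : σ (m j + d) = σ (m j) := by
        funext i
        rw [σcongr _ _ _ (flatDirections_congr (τloc i) (hline i))]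
        refine σstable _ _ _ ?_ ?_
        · exact flatDirections_anti (τmono i) le_self_add ((σmem (m j) i).2 _).symm
        · refine ⟨cσ _ _, fun n => ?_⟩
          rw [add_assoc, ← Finsupp.single_add, (σmem (m j) i).2, (σmem (m j) i).2]
      refine ⟨?_, ?_⟩
      · rw [hA]
        exact ((hA _).1 (hmA j)).trans (Finset.sum_le_sum fun i _ => hmono i le_self_add)
      · rw [← hmκ j, κeq]
        refine ⟨hτm, hσm, fun v hv => ?_⟩
        rw [hσm] at hv
        exact htr v hv
  · intro a
    exact ⟨fun ha => ⟨⟨κ a, a, ha, rfl⟩, ha, rfl⟩, fun ⟨_, ha, _⟩ => ha⟩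
  · rintro i j a ⟨-, hi⟩ ⟨-, hj⟩
    exact Subtype.ext (hi.symm.trans hj)
  · intro j
    have hinj : Function.Injective (σ (m j)) := fun i i' h => by
      rw [← cσ (m j) i, h, cσ]
    rw [← Finset.card_univ, ← Finset.card_image_of_injective _ hinj]
    refine Finset.card_le_card fun v hv => ?_
    obtain ⟨i, -, rfl⟩ := Finset.mem_image.1 hv
    simp [cσ]

end Partition

/-! ### Matchings with multiplicities and Kőnig's theorem. -/

section Matching

variable {V : Type*}

theorem HasMatching.zero (E : Set (V →₀ ℕ)) (a : V →₀ ℕ) : HasMatching E 0 a :=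
  ⟨0, by simp, by simp, by simp⟩

theorem HasMatching.mono_right {E : Set (V →₀ ℕ)} {m : ℕ} {a b : V →₀ ℕ}
    (h : HasMatching E m a) (hab : a ≤ b) : HasMatching E m b := by
  obtain ⟨s, hs, hm, hle⟩ := h
  exact ⟨s, hs, hm, hle.trans hab⟩

theorem HasMatching.anti {E : Set (V →₀ ℕ)} {m n : ℕ} {a : V →₀ ℕ}
    (h : HasMatching E n a) (hmn : m ≤ n) : HasMatching E m a := by
  induction hmn with
  | refl => exact h
  | step _ ih =>
    obtain ⟨s, hs, hm, hle⟩ := h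
    obtain ⟨e, he⟩ := Multiset.card_pos_iff_exists_mem.1 (by omega : 0 < s.card)
    obtain ⟨s, rfl⟩ := Multiset.exists_cons_of_mem he
    refine ih ⟨s, fun x hx => hs x (Multiset.mem_cons_of_mem hx), by simpa using hm, ?_⟩
    rw [Multiset.sum_cons] at hle
    exact le_add_self.trans hle

theorem Multiset.sum_apply_le_card {s : Multiset (V →₀ ℕ)} {v : V} (h : ∀ e ∈ s, e v ≤ 1) :
    s.sum v ≤ s.card := by
  induction s using Multiset.induction with
  | empty => simp
  | cons e s ih =>
    have h1 := h e (Multiset.mem_cons_self e s)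
    have h2 := ih fun x hx => h x (Multiset.mem_cons_of_mem hx)
    simp only [Multiset.sum_cons, Finsupp.add_apply, Multiset.card_cons]
    omega

theorem Multiset.sum_apply_eq_zero {s : Multiset (V →₀ ℕ)} {v : V} (h : ∀ e ∈ s, e v = 0) :
    s.sum v = 0 := by
  induction s using Multiset.induction with
  | empty => simp
  | cons e s ih =>
    have h1 := h e (Multiset.mem_cons_self e s)
    have h2 := ih fun x hx => h x (Multiset.mem_cons_of_mem hx)
    simp only [Multiset.sum_cons, Finsupp.add_apply]
    omega

/-- The weight of a vertex cover bounds the size of a matching. -/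
theorem HasMatching.le_sum_cover {E : Set (V →₀ ℕ)} {m : ℕ} {a : V →₀ ℕ}
    (h : HasMatching E m a) {C : Finset V} (hC : ∀ e ∈ E, ∃ v ∈ C, 1 ≤ e v) :
    m ≤ ∑ v ∈ C, a v := by
  obtain ⟨s, hs, rfl, hle⟩ := h
  refine le_trans ?_ (Finset.sum_le_sum fun v _ => hle v)
  clear hle
  induction s using Multiset.induction with
  | empty => simp
  | cons e s ih =>
    have h2 := ih fun x hx => hs x (Multiset.mem_cons_of_mem hx)
    obtain ⟨v, hv, hev⟩ := hC e (hs e (Multiset.mem_cons_self e s))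
    have h1 : e v ≤ ∑ v ∈ C, e v := Finset.single_le_sum (fun _ _ => Nat.zero_le _) hv
    simp only [Multiset.sum_cons, Finsupp.add_apply, Finset.sum_add_distrib, Multiset.card_cons]
    omega

/-- The exponents of the products `x_v x_w`, for `v` and `w` related by `r`. -/
def relExponents (r : V → V → Prop) : Set (V →₀ ℕ) :=
  {e | ∃ v w, r v w ∧ e = Finsupp.single v 1 + Finsupp.single w 1}

/-- A weighted form of Kőnig's theorem: in a bipartite graph there is a matching with vertex
multiplicities `a` at least as large as the weight of some vertex cover of the form
`(X \ S) ∪ N(S)`. -/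
theorem exists_hasMatching_cover [Fintype V] [DecidableEq V] (r : V → V → Prop)
    [DecidableRel r] (X : Finset V) (hr : ∀ x y, r x y → x ∈ X ∧ y ∉ X) (a : V →₀ ℕ) :
    ∃ S ⊆ X, HasMatching (relExponents r)
      (∑ v ∈ (X \ S) ∪ Finset.univ.filter (fun y => ∃ x ∈ S, r x y), a v) a := by
  classical
  let N : Finset V → Finset V := fun S => Finset.univ.filter fun y => ∃ x ∈ S, r x y
  have hN : ∀ S y, y ∈ N S ↔ ∃ x ∈ S, r x y := fun S y => by simp [N]
  let B : Finset V → Finset (Σ _ : V, ℕ) := fun S => S.sigma fun v => Finset.range (a v)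
  have hB : ∀ S, (B S).card = ∑ v ∈ S, a v := fun S => by simp [B]
  -- `S` has the largest deficiency `d = a(S) - a(N(S))`. With `a v` copies of each vertex and `d`
  -- dummy partners added, Hall's condition holds.
  obtain ⟨S, hSX, hmax⟩ := X.powerset.exists_max_image
    (fun S => (∑ v ∈ S, a v : ℤ) - ∑ v ∈ N S, (a v : ℤ)) ⟨∅, by simp⟩
  rw [Finset.mem_powerset] at hSX
  have hNempty : N ∅ = ∅ := by simp [N]
  obtain ⟨d, hd⟩ : ∃ d : ℕ, (d : ℤ) = (∑ v ∈ S, a v : ℤ) - ∑ v ∈ N S, (a v : ℤ) := by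
    have h0 := hmax ∅ (by simp)
    rw [hNempty] at h0
    simp only [Finset.sum_empty, sub_zero] at h0
    exact ⟨_, Int.toNat_of_nonneg h0⟩
  let t : B X → Finset ((Σ _ : V, ℕ) ⊕ ℕ) := fun p =>
    (B (N {p.1.1})).disjSum (Finset.range d)
  have hall : ∀ s : Finset (B X), s.card ≤ (s.biUnion t).card := by
    intro s
    rcases s.eq_empty_or_nonempty with rfl | ⟨p₀, hp₀⟩
    · simp
    let T : Finset V := s.image fun p => p.1.1
    have hTX : T ⊆ X := by
      intro v hv
      obtain ⟨p, -, rfl⟩ := Finset.mem_image.1 hv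
      exact (Finset.mem_sigma.1 p.2).1
    have h1 : s.card ≤ (B T).card := by
      refine Finset.card_le_card_of_injOn (fun p => p.1) (fun p hp => ?_)
        (Subtype.val_injective.injOn)
      exact Finset.mem_sigma.2 ⟨Finset.mem_image_of_mem _ hp, (Finset.mem_sigma.1 p.2).2⟩
    have h2 : (B (N T)).disjSum (Finset.range d) ⊆ s.biUnion t := by
      intro q hq
      rw [Finset.mem_biUnion]
      rcases Finset.mem_disjSum.1 hq with ⟨q, hq', rfl⟩ | ⟨n, hn, rfl⟩
      · obtain ⟨hq1, hq2⟩ := Finset.mem_sigma.1 hq'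
        obtain ⟨x, hx, hxq⟩ := (hN _ _).1 hq1
        obtain ⟨p, hp, rfl⟩ := Finset.mem_image.1 hx
        refine ⟨p, hp, Finset.inl_mem_disjSum.2 (Finset.mem_sigma.2 ⟨?_, hq2⟩)⟩
        exact (hN _ _).2 ⟨_, Finset.mem_singleton_self _, hxq⟩
      · exact ⟨p₀, hp₀, Finset.inr_mem_disjSum.2 hn⟩
    have h3 := Finset.card_le_card h2
    rw [Finset.card_disjSum, hB, Finset.card_range] at h3
    rw [hB] at h1
    have h4 := hmax T (Finset.mem_powerset.2 hTX)
    zify at h1 h3 ⊢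
    linarith
  obtain ⟨f, finj, hf⟩ := (Finset.all_card_le_biUnion_card_iff_exists_injective t).1 hall
  -- The value at copies matched to a dummy is irrelevant; `g` is used only on `L`.
  let g : B X → V := fun p => Sum.elim (fun q => q.1) (fun _ => p.1.1) (f p)
  let L : Finset (B X) := Finset.univ.filter fun p => (f p).isLeft
  have hL : ∀ p ∈ L, ∃ n < a (g p), f p = Sum.inl ⟨g p, n⟩ ∧ r p.1.1 (g p) := by
    intro p hp
    have hp' := (Finset.mem_filter.1 hp).2
    have hfp := hf p
    obtain ⟨q, hq⟩ := Sum.isLeft_iff.1 hp'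
    rw [hq] at hfp
    obtain ⟨hq1, hq2⟩ := Finset.mem_sigma.1 (Finset.inl_mem_disjSum.1 hfp)
    have hg : g p = q.1 := by simp [g, hq]
    rw [hg]
    refine ⟨q.2, Finset.mem_range.1 hq2, hq, ?_⟩
    obtain ⟨x, hx, hxq⟩ := (hN _ _).1 hq1
    rwa [Finset.mem_singleton.1 hx] at hxq
  have hLcard : ∑ v ∈ X, a v ≤ L.card + d := by
    have h1 : (Finset.univ.filter fun p => ¬ (f p).isLeft).card ≤ d := by
      have hinj : Set.InjOn f (Finset.univ.filter fun p => ¬ (f p).isLeft) := finj.injOn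
      have := Finset.card_le_card_of_injOn (t := (Finset.range d).map ⟨Sum.inr, Sum.inr_injective⟩)
        f (fun p hp => ?_) hinj
      · simpa using this
      · have hp' := (Finset.mem_filter.1 hp).2
        have hfp := hf p
        obtain ⟨n, hn⟩ := Sum.isRight_iff.1 (Sum.not_isLeft.1 hp')
        rw [hn] at hfp ⊢
        simpa using Finset.inr_mem_disjSum.1 hfp
    have h2 := Finset.card_filter_add_card_filter_not (s := (Finset.univ : Finset (B X)))
      (fun p => (f p).isLeft)
    rw [Finset.card_univ, Fintype.card_coe, hB] at h2
    simp only [L]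
    omega
  have hmatch : HasMatching (relExponents r) L.card a := by
    refine ⟨L.val.map fun p => Finsupp.single p.1.1 1 + Finsupp.single (g p) 1, ?_, by simp, ?_⟩
    · intro e he
      obtain ⟨p, hp, rfl⟩ := Multiset.mem_map.1 he
      obtain ⟨n, -, -, h⟩ := hL p hp
      exact ⟨_, _, h, rfl⟩
    · change ∑ p ∈ L, _ ≤ a
      intro v
      rw [Finsupp.finsetSum_apply]
      simp only [Finsupp.add_apply, Finset.sum_add_distrib, Finsupp.single_apply]
      rw [← Finset.card_filter, ← Finset.card_filter]
      -- A vertex of `X` is used at most once per copy of it; any other vertex is bounded by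
      -- injectivity of `f`.
      by_cases hv : v ∈ X
      · have h0 : L.filter (fun p => g p = v) = ∅ := by
          refine Finset.filter_eq_empty_iff.2 fun p hp hpv => ?_
          obtain ⟨n, -, -, h⟩ := hL p hp
          exact (hr _ _ h).2 (hpv ▸ hv)
        rw [h0, Finset.card_empty, add_zero, ← Finset.card_range (a v)]
        refine Finset.card_le_card_of_injOn (fun p => p.1.2) (fun p hp => ?_) ?_
        · obtain ⟨-, rfl⟩ := Finset.mem_filter.1 hp
          exact (Finset.mem_sigma.1 p.2).2
        · intro p hp q hq hpq
          have hp' := (Finset.mem_filter.1 hp).2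
          have hq' := (Finset.mem_filter.1 hq).2
          exact Subtype.ext (Sigma.ext (hp'.trans hq'.symm) (heq_of_eq hpq))
      · have h0 : L.filter (fun p => p.1.1 = v) = ∅ := by
          refine Finset.filter_eq_empty_iff.2 fun p hp hpv => ?_
          exact hv (hpv ▸ (Finset.mem_sigma.1 p.2).1)
        rw [h0, Finset.card_empty, zero_add, ← Finset.card_range (a v)]
        refine (Finset.card_le_card_of_injOn (t := (Finset.range (a v)).image
          fun n => (Sum.inl ⟨v, n⟩ : (Σ _ : V, ℕ) ⊕ ℕ)) f (fun p hp => ?_) finj.injOn).trans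
          Finset.card_image_le
        obtain ⟨hpL, rfl⟩ := Finset.mem_filter.1 hp
        obtain ⟨n, hn, hfn, -⟩ := hL p hpL
        exact Finset.mem_coe.2 (Finset.mem_image.2 ⟨n, Finset.mem_range.2 hn, hfn.symm⟩)
  -- At most `d` copies are lost to dummies, which leaves at least `a(X) - d = a(X \ S) + a(N(S))`
  -- edges.
  refine ⟨S, hSX, hmatch.anti ?_⟩
  have h1 := Finset.sum_union_inter (s₁ := X \ S) (s₂ := N S) (f := a)
  have h2 := Finset.sum_sdiff (f := a) hSX
  change ∑ v ∈ (X \ S) ∪ N S, a v ≤ _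
  zify at h1 h2 hLcard ⊢
  have h3 : (0 : ℤ) ≤ ∑ v ∈ (X \ S) ∩ N S, (a v : ℤ) := Finset.sum_nonneg fun _ _ => by positivity
  linarith

/-- In a bipartite graph on `B` there is a vertex whose multiplicity does not affect the largest
matchings. -/
theorem exists_flat_vertex [Finite V] (r : V → V → Prop) {X B : Set V} (hB : B.Nonempty)
    (hXB : X ⊆ B) (hr : ∀ x y, r x y → x ∈ X ∧ y ∈ B \ X) (a : V →₀ ℕ) :
    ∃ v ∈ B, ∀ m n, HasMatching (relExponents r) m (a + Finsupp.single v n) →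
      HasMatching (relExponents r) m a := by
  classical
  have := Fintype.ofFinite V
  obtain ⟨S, hS, hmatch⟩ := exists_hasMatching_cover r X.toFinset
    (fun x y h => by simpa using ⟨(hr x y h).1, (hr x y h).2.2⟩) a
  set C := (X.toFinset \ S) ∪ Finset.univ.filter (fun y => ∃ x ∈ S, r x y) with hC
  have hcover : ∀ e ∈ relExponents r, ∃ v ∈ C, 1 ≤ e v := by
    rintro _ ⟨x, y, h, rfl⟩
    by_cases hx : x ∈ S
    · exact ⟨y, Finset.mem_union_right _ (by simpa using ⟨x, hx, h⟩), by simp⟩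
    · exact ⟨x, Finset.mem_union_left _ (by simpa [hx] using (hr x y h).1), by simp⟩
  have key : ∀ v ∉ C, ∀ m n, HasMatching (relExponents r) m (a + Finsupp.single v n) →
      HasMatching (relExponents r) m a := by
    intro v hv m n h
    refine hmatch.anti ((h.le_sum_cover hcover).trans_eq (Finset.sum_congr rfl fun w hw => ?_))
    rw [Finsupp.add_apply, Finsupp.single_eq_of_ne, add_zero]
    rintro rfl
    exact hv hw
  -- A vertex of `B` outside the cover is needed. Any vertex of `S` qualifies; if `S` is empty the
  -- cover is `X`, and the far end of any edge does. Without edges every vertex is flat.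
  rcases S.eq_empty_or_nonempty with rfl | ⟨v, hv⟩
  · by_cases hy : ∃ x y, r x y
    · obtain ⟨x, y, h⟩ := hy
      exact ⟨y, (hr x y h).2.1, key y (by simp [hC, (hr x y h).2.2])⟩
    · obtain ⟨v, hv⟩ := hB
      refine ⟨v, hv, fun m n h => ?_⟩
      have h0 := h.le_sum_cover (C := ∅) (by
        rintro _ ⟨x, y, hxy, -⟩
        exact absurd ⟨x, y, hxy⟩ hy)
      rw [Finset.sum_empty, Nat.le_zero] at h0
      rw [h0]
      exact HasMatching.zero _ _
  · have hvX : v ∈ X := by simpa using hS hv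
    refine ⟨v, hXB hvX, key v ?_⟩
    simp only [hC, Finset.mem_union, Finset.mem_sdiff, hv, not_true, and_false, false_or,
      Finset.mem_filter, Finset.mem_univ, true_and]
    rintro ⟨x, -, h⟩
    exact (hr x v h).2.2 hvX

end Matching

/-! ### Splitting matchings over blocks of vertices. -/

section Blocks

variable {V ι : Type*}

/-- The exponents of the edges of `G` inside the block `i` of `c`. -/
def blockExponents (G : SimpleGraph V) (c : V → ι) (i : ι) : Set (V →₀ ℕ) :=
  relExponents fun v w => G.Adj v w ∧ c v = i

/-- The size, truncated at `k`, of the largest matchings with vertex multiplicities `a`. -/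
noncomputable def matchingOrder (E : Set (V →₀ ℕ)) (k : ℕ) (a : V →₀ ℕ) : ℕ :=
  open Classical in Nat.findGreatest (fun m => HasMatching E m a) k

theorem matchingOrder_le (E : Set (V →₀ ℕ)) (k : ℕ) (a : V →₀ ℕ) : matchingOrder E k a ≤ k := by
  classical
  exact Nat.findGreatest_le k

theorem hasMatching_matchingOrder (E : Set (V →₀ ℕ)) (k : ℕ) (a : V →₀ ℕ) :
    HasMatching E (matchingOrder E k a) a := by
  classical
  exact Nat.findGreatest_spec (P := fun m => HasMatching E m a) (Nat.zero_le k)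
    (HasMatching.zero E a)

theorem HasMatching.le_matchingOrder {E : Set (V →₀ ℕ)} {k m : ℕ} {a : V →₀ ℕ} (hm : m ≤ k)
    (h : HasMatching E m a) : m ≤ matchingOrder E k a := by
  classical
  exact Nat.le_findGreatest hm h

theorem matchingOrder_mono (E : Set (V →₀ ℕ)) (k : ℕ) : Monotone (matchingOrder E k) :=
  fun a _ hab => ((hasMatching_matchingOrder E k a).mono_right hab).le_matchingOrder
    (matchingOrder_le E k a)

variable {G : SimpleGraph V} {c : V → ι}

theorem blockExponents_apply_le {i : ι} {e : V →₀ ℕ} (he : e ∈ blockExponents G c i) (v : V) :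
    e v ≤ 1 := by
  classical
  obtain ⟨x, y, ⟨h, -⟩, rfl⟩ := he
  have := h.ne
  simp only [Finsupp.add_apply, Finsupp.single_apply]
  split_ifs with h1 h2 <;> simp_all

theorem blockExponents_apply_eq_zero (hc : ∀ v w, G.Adj v w → c v = c w) {i : ι} {e : V →₀ ℕ}
    (he : e ∈ blockExponents G c i) {v : V} (hv : c v ≠ i) : e v = 0 := by
  classical
  obtain ⟨x, y, ⟨h, rfl⟩, rfl⟩ := he
  have := hc x y h
  simp only [Finsupp.add_apply, Finsupp.single_apply]
  split_ifs with h1 h2 <;> simp_all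

/-- There are no loops, so a matching with at most `k` edges uses a vertex at most `k` times; larger
multiplicities are invisible. -/
theorem isLocal_matchingOrder (hc : ∀ v w, G.Adj v w → c v = c w) (k : ℕ) (i : ι) :
    IsLocal k (c ⁻¹' {i}) (matchingOrder (blockExponents G c i) k) := by
  have key : ∀ a b, TruncEqOn k (c ⁻¹' {i}) a b →
      matchingOrder (blockExponents G c i) k a ≤ matchingOrder (blockExponents G c i) k b := by
    intro a b hab
    have hk := matchingOrder_le (blockExponents G c i) k a
    obtain ⟨s, hs, hcard, hle⟩ := hasMatching_matchingOrder (blockExponents G c i) k a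
    refine HasMatching.le_matchingOrder hk ⟨s, hs, hcard, fun v => ?_⟩
    by_cases hv : c v = i
    · have h1 := Multiset.sum_apply_le_card (v := v) fun e he => blockExponents_apply_le (hs e he) v
      have h2 := hle v
      have h3 := hab v hv
      omega
    · rw [Multiset.sum_apply_eq_zero fun e he => blockExponents_apply_eq_zero hc (hs e he) hv]
      exact Nat.zero_le _
  exact fun a b hab => le_antisymm (key a b hab) (key b a fun v hv => (hab v hv).symm)

/-- Sorting edges by block splits a matching, and matchings in different blocks share no vertices,
so they add. Truncation at `k` is harmless, since no part of a matching of size `k` exceeds `k`. -/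
theorem hasMatching_iff_le_sum [Fintype ι] (hc : ∀ v w, G.Adj v w → c v = c w) (k : ℕ)
    (a : V →₀ ℕ) : HasMatching (edgeExponents G) k a ↔
      k ≤ ∑ i, matchingOrder (blockExponents G c i) k a := by
  classical
  constructor
  · rintro ⟨s, hs, rfl, hle⟩
    have h1 : ∀ i, s.countP (· ∈ blockExponents G c i) ≤
        matchingOrder (blockExponents G c i) s.card a := by
      intro i
      refine HasMatching.le_matchingOrder (Multiset.countP_le_card _ _)
        ⟨s.filter (· ∈ blockExponents G c i), fun e he => (Multiset.mem_filter.1 he).2,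
          (Multiset.countP_eq_card_filter _ _).symm, le_trans ?_ hle⟩
      conv_rhs => rw [← Multiset.filter_add_not (· ∈ blockExponents G c i) s, Multiset.sum_add]
      exact le_self_add
    refine le_trans ?_ (Finset.sum_le_sum fun i _ => h1 i)
    clear h1 hle
    induction s using Multiset.induction with
    | empty => simp
    | cons e s ih =>
      have h2 := ih fun x hx => hs x (Multiset.mem_cons_of_mem hx)
      obtain ⟨v, w, hvw, he⟩ := hs e (Multiset.mem_cons_self e s)
      have h3 : 1 ≤ ∑ i, if e ∈ blockExponents G c i then 1 else 0 := by
        refine le_trans ?_ (Finset.single_le_sum (fun _ _ => Nat.zero_le _)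
          (Finset.mem_univ (c v)))
        rw [if_pos ⟨v, w, ⟨hvw, rfl⟩, he⟩]
      simp only [Multiset.countP_cons, Finset.sum_add_distrib, Multiset.card_cons]
      omega
  · intro hk
    choose s hs hcard hle using fun i => hasMatching_matchingOrder (blockExponents G c i) k a
    refine HasMatching.anti ⟨∑ i, s i, ?_, ?_, ?_⟩ hk
    · intro e he
      obtain ⟨i, -, hi⟩ := Multiset.mem_sum.1 he
      obtain ⟨v, w, ⟨h, -⟩, rfl⟩ := hs i e hi
      exact ⟨v, w, h, rfl⟩
    · rw [Multiset.card_sum]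
      exact Finset.sum_congr rfl fun i _ => hcard i
    · intro v
      have h1 : (∑ i, s i).sum = ∑ i, (s i).sum := map_sum Multiset.sumAddMonoidHom s _
      rw [h1, Finsupp.finsetSum_apply, Finset.sum_eq_single (c v)]
      · exact hle _ v
      · intro i _ hi
        exact Multiset.sum_apply_eq_zero fun e he =>
          blockExponents_apply_eq_zero hc (hs i e he) (Ne.symm hi)
      · intro h
        exact absurd (Finset.mem_univ _) h

theorem flatDirections_matchingOrder_nonempty [Finite V] (hc : ∀ v w, G.Adj v w → c v = c w)
    (k : ℕ) {i : ι} (hi : ∃ v, c v = i) {X : Set V} (hX : ∀ v ∈ X, c v = i)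
    (hbip : ∀ v w, G.Adj v w → c v = i → (v ∈ X ↔ w ∉ X)) (a : V →₀ ℕ) :
    (flatDirections (matchingOrder (blockExponents G c i) k) (c ⁻¹' {i}) a).Nonempty := by
  -- The exponent of an edge ignores its orientation, so every edge may be taken to start in `X`.
  have hE : blockExponents G c i = relExponents fun v w => G.Adj v w ∧ v ∈ X := by
    ext e
    constructor
    · rintro ⟨v, w, ⟨h, hv⟩, rfl⟩
      by_cases hvX : v ∈ X
      · exact ⟨v, w, ⟨h, hvX⟩, rfl⟩
      · have hwX : w ∈ X := not_not.1 fun hw => hvX ((hbip v w h hv).2 hw)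
        exact ⟨w, v, ⟨h.symm, hwX⟩, add_comm _ _⟩
    · rintro ⟨v, w, ⟨h, hv⟩, rfl⟩
      exact ⟨v, w, ⟨h, hX v hv⟩, rfl⟩
  rw [hE]
  obtain ⟨v, hv, hflat⟩ := exists_flat_vertex (fun v w => G.Adj v w ∧ v ∈ X)
    (B := c ⁻¹' {i}) hi (fun v hv => hX v hv) (fun x y h => ⟨h.2, by
      rw [Set.mem_sdiff, Set.mem_preimage, Set.mem_singleton_iff, ← hc x y h.1]
      exact ⟨hX x h.2, (hbip x y h.1 (hX x h.2)).1 h.2⟩⟩) a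
  refine ⟨v, hv, fun n => le_antisymm ?_ (matchingOrder_mono _ k le_self_add)⟩
  exact (hflat _ n (hasMatching_matchingOrder _ _ _)).le_matchingOrder (matchingOrder_le _ _ _)

end Blocks

/-! ### Bipartite components and the final bound. -/

theorem exists_not_isBipartite_component {V : Type*} {G : SimpleGraph V}
    (hG : ¬ G.IsBipartite) : ∃ C : G.ConnectedComponent, ¬ C.toSimpleGraph.IsBipartite := by
  by_contra! h
  have col := fun C => (h C).some
  exact hG ⟨SimpleGraph.Coloring.mk
    (fun v => col (G.connectedComponentMk v) ⟨v, rfl⟩) (by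
      intro v w hvw heq
      have hC := SimpleGraph.ConnectedComponent.connectedComponentMk_eq_of_adj hvw
      -- The components of `v` and `w` are equal only propositionally; a general `C` allows the
      -- transport between their colourings.
      have hgen : ∀ (C : G.ConnectedComponent) (hw : w ∈ C.supp),
          col C ⟨w, hw⟩ = col (G.connectedComponentMk w) ⟨w, rfl⟩ := by
        rintro _ rfl
        rfl
      rw [← hgen (G.connectedComponentMk v) hC.symm] at heq
      exact (col (G.connectedComponentMk v)).valid
        (show (G.connectedComponentMk v).toSimpleGraph.Adj ⟨v, rfl⟩ ⟨w, hC.symm⟩ from hvw) heq)⟩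

theorem corollary3p2 (K : Type*) [Field K] (V : Type*) [Finite V] (G : SimpleGraph V)
    (hG : ¬ G.IsBipartite) (k : ℕ) (hk : 1 ≤ k) :
    ((StanleyDepth.numBipartiteComponents G + 1 : ℕ) : ℕ∞) ≤
      StanleyDepth.idealSdepth (StanleyDepth.edgeIdeal K G ^ k) := by
  classical
  let β := {C : G.ConnectedComponent | C.toSimpleGraph.IsBipartite}
  have : Fintype β := Fintype.ofFinite β
  -- `none` collects all non-bipartite components into one block; it supplies the `+ 1`.
  let c : V → Option β := fun v =>
    if h : G.connectedComponentMk v ∈ β then some ⟨_, h⟩ else none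
  have hc : ∀ v w, G.Adj v w → c v = c w := by
    intro v w h
    simp only [c, SimpleGraph.ConnectedComponent.connectedComponentMk_eq_of_adj h]
  have hcsome : ∀ v (C : β), c v = some C ↔ G.connectedComponentMk v = C := by
    intro v C
    simp only [c]
    split_ifs with h
    · rw [Option.some_inj, Subtype.ext_iff]
    · simp only [false_iff]
      intro hC
      exact h (hC ▸ C.2)
  obtain ⟨C₀, hC₀⟩ := exists_not_isBipartite_component hG
  have hnone : ∃ v, c v = none := by
    obtain ⟨v, rfl⟩ := C₀.exists_rep
    exact ⟨v, dif_neg hC₀⟩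
  have hflat : ∀ i ≠ none, ∀ a, (flatDirections (matchingOrder (blockExponents G c i) k)
      (c ⁻¹' {i}) a).Nonempty := by
    rintro (_ | C) hi a
    · exact absurd rfl hi
    obtain ⟨col⟩ := C.2
    have hmem : ∀ v, c v = some C → v ∈ C.1.supp := fun v hv => (hcsome v C).1 hv
    refine flatDirections_matchingOrder_nonempty hc k ?_
      (X := {v | ∃ h : v ∈ C.1.supp, col ⟨v, h⟩ = 0}) ?_ ?_ a
    · obtain ⟨v, hv⟩ := C.1.exists_rep
      exact ⟨v, (hcsome v C).2 hv⟩
    · rintro v ⟨h, -⟩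
      exact (hcsome v C).2 h
    · intro v w hvw hv
      have hv' := hmem v hv
      have hw' := hmem w (by rw [← hc v w hvw, hv])
      have hne : col ⟨v, hv'⟩ ≠ col ⟨w, hw'⟩ :=
        col.valid (show C.1.toSimpleGraph.Adj ⟨v, hv'⟩ ⟨w, hw'⟩ from hvw)
      simp only [Set.mem_ofPred_eq, hv', hw', exists_true_left]
      -- Two distinct elements of `Fin 2`: exactly one of them is `0`.
      generalize col ⟨v, hv'⟩ = x at hne
      generalize col ⟨w, hw'⟩ = y at hne
      omega
  obtain ⟨J, _, E, m, Z, hE, hA, hdisj, hcard⟩ := exists_partition c k k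
    (fun i => matchingOrder (blockExponents G c i) k) (fun i => matchingOrder_mono _ k)
    (fun i => isLocal_matchingOrder hc k i) none hnone hflat
    {a | HasMatching (edgeExponents G) k a} (fun a => hasMatching_iff_le_sum hc k a)
  refine le_idealSdepth_of_partition (mem_edgeIdeal_pow G k) E m Z hE hA hdisj fun j => ?_
  refine le_trans (le_of_eq ?_) (hcard j)
  rw [Fintype.card_option, ← Nat.card_eq_fintype_card]
  rfl
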